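/- All Hilbert spaces are complex and finite-dimensional, an alphabet is a non-empty finite set, and for an alphabet $\mathcal{A}$ we write $\mathsf{A}=\mathbb{C}^{\mathcal{A}}$ and identify $a\in\mathcal{A}$ with the density operator $|a\rangle\langle a|$. $\mathcal{L}(\mathsf{H})$ is the space of linear operators on $\mathsf{H}$, a channel is a completely positive trace-preserving linear map $\mathcal{L}(\mathsf{H})\to\mathcal{L}(\mathsf{H}')$, and $\|X\|_1=\operatorname{Tr}\sqrt{X^\dagger X}$. A QECM (quantum encryption of classical messages) is a triple $(K,E,D)$ of channels $K:\mathcal{L}(\mathbb{C})\to\mathcal{L}(\mathsf{K})$, $E:\mathcal{L}(\mathsf{K}\otimes\mathsf{M})\to\mathcal{L}(\mathsf{C})$, $D:\mathcal{L}(\mathsf{K}\otimes\mathsf{C})\to\mathcal{L}(\mathsf{M})$, for alphabets $\mathcal{K}$ (keys), $\mathcal{M}$ (messages) and a Hilbert space $\mathsf{C}$. Put $E_k(\rho)=E(k\otimes\rho)$ and $D_k(\rho)=D(k\otimes\rho)$, and let $\mathbb{E}_k$ denote the expectation over a key $k$ sampled with probability $\langle k|K(1)|k\rangle$. A QECMR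 (QECM with revocation) is a tuple $S=(K,E,D,R,V)$ where $(K,E,D)$ is a QECM and $R:\mathcal{L}(\mathsf{C})\to\mathcal{L}(\mathsf{R})$ and $V:\mathcal{L}(\mathsf{K}\otimes\mathsf{R})\to\mathcal{L}(\mathbb{C}^{\{0,1\}})$ are channels, for an alphabet $\mathcal{R}$. Put $\overline{V}_k(\rho)=\langle 1|V(k\otimes\rho)|1\rangle$. For real numbers $\epsilon,\delta,\eta$: - $S$ is $\epsilon$-correct if for all $m\in\mathcal{M}$ both $\mathbb{E}_k\langle m|D_k(E_k(m))|m\rangle\ge 1-\epsilon$ and $\mathbb{E}_k\overline{V}_k(R(E_k(m)))\ge 1-\epsilon$. - $S$ has $\delta$-revocation security if for all $m,m'\in\mathcal{M}$, every Hilbert space $\mathsf{A}$ and every channel $A:\mathcal{L}(\mathsf{C})\to\mathcal{L}(\mathsf{R}\otimes\mathsf{A})$, $$\mathbb{E}_k\,\tfrac12\left\|(\overline{V}_k\otimes\mathrm{Id}_{\mathsf{A}})\circ A\circ E_k(m-m')\right\|_1\le\delta.$$ - $(K,E,D)$ is $\eta$-encrypting if for all $m_0,m_1\in\mathcal{M}$,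 $\tfrac12\left\|\mathbb{E}_k E_k(m_0-m_1)\right\|_1\le\eta$. Corollary (revocation implies encryption). Let $S=(K,E,D,R,V)$ be an $\epsilon$-correct QECMR with $\delta$-revocation security. Then the QECM $(K,E,D)$ is $\sqrt{19\left(\sqrt{\delta}+2\sqrt[8]{\epsilon}\right)}$-encrypting. -/

import Mathlib

open scoped Kronecker MatrixOrder ComplexOrder

namespace QuantumRevocation

noncomputable section

/-- `Op ι` is the space `L(ℂ^ι)` of linear operators on the Hilbert space `ℂ^ι`, written as
matrices in its orthonormal (computational) basis.  All Hilbert spaces are finite-dimensional. The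
space `ℂ^ι ⊗ ℂ^κ` is `ℂ^(ι × κ)`, and `ℂ` is `ℂ^Unit`. -/
abbrev Op (ι : Type*) := Matrix ι ι ℂ

/-- The density operator `|a⟩⟨a|` of a computational basis state. -/
def basisState {ι : Type*} [DecidableEq ι] (a : ι) : Op ι := Matrix.single a a 1

/-- The Schatten 1-norm `‖X‖₁ = Tr √(X† X)`. -/
def traceNorm {ι : Type*} [Fintype ι] [DecidableEq ι] (X : Op ι) : ℝ :=
  (CFC.sqrt (X.conjTranspose * X)).trace.re

/-- The map `Φ ⊗ Id` on `L(ℂ^ι ⊗ ℂ^ζ)`: `Φ` is applied to the `ι`-block at each pair of indices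
`z, w : ζ`. -/
def tensorId {ι κ : Type*} (Φ : Op ι →ₗ[ℂ] Op κ) (ζ : Type*) : Op (ι × ζ) →ₗ[ℂ] Op (κ × ζ) where
  toFun X := Matrix.of fun p q => Φ (Matrix.of fun i j => X (i, p.2) (j, q.2)) p.1 q.1
  map_add' X Y := by
    ext p q
    exact congrFun (congrFun (Φ.map_add (Matrix.of fun i j => X (i, p.2) (j, q.2))
      (Matrix.of fun i j => Y (i, p.2) (j, q.2))) p.1) q.1
  map_smul' c X := by
    ext p q
    exact congrFun (congrFun (Φ.map_smul c (Matrix.of fun i j => X (i, p.2) (j, q.2))) p.1) q.1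

/-- The map `φ ⊗ Id : L(ℂ^ι ⊗ ℂ^ζ) → L(ℂ ⊗ ℂ^ζ) = L(ℂ^ζ)` for a linear functional `φ` on
`L(ℂ^ι)`. -/
def functionalTensorId {ι : Type*} (φ : Op ι →ₗ[ℂ] ℂ) (ζ : Type*) : Op (ι × ζ) →ₗ[ℂ] Op ζ where
  toFun X := Matrix.of fun z w => φ (Matrix.of fun i j => X (i, z) (j, w))
  map_add' X Y := by
    ext z w
    exact φ.map_add (Matrix.of fun i j => X (i, z) (j, w)) (Matrix.of fun i j => Y (i, z) (j, w))
  map_smul' c X := by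
    ext z w
    exact φ.map_smul c (Matrix.of fun i j => X (i, z) (j, w))

/-- A channel: a completely positive and trace-preserving linear map. The auxiliary Hilbert space
in complete positivity ranges over all `ℂ^n`. -/
structure IsChannel {ι κ : Type*} [Fintype ι] [Fintype κ] (Φ : Op ι →ₗ[ℂ] Op κ) : Prop where
  completelyPositive : ∀ (n : ℕ) (X : Op (ι × Fin n)),
    X.PosSemidef → (tensorId Φ (Fin n) X).PosSemidef
  tracePreserving : ∀ X : Op ι, (Φ X).trace = X.trace

/-- A quantum encryption of classical messages: key generation, encoding and decoding channels,
with keys `𝓚`, messages `𝓜` and ciphertext space `ℂ^𝓒`. -/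
structure QECM (𝓚 𝓜 𝓒 : Type*) [Fintype 𝓚] [DecidableEq 𝓚] [Fintype 𝓜] [DecidableEq 𝓜]
    [Fintype 𝓒] [DecidableEq 𝓒] where
  /-- key generation -/
  K : Op Unit →ₗ[ℂ] Op 𝓚
  /-- encoding -/
  E : Op (𝓚 × 𝓜) →ₗ[ℂ] Op 𝓒
  /-- decoding -/
  D : Op (𝓚 × 𝓒) →ₗ[ℂ] Op 𝓜
  isChannel_K : IsChannel K
  isChannel_E : IsChannel E
  isChannel_D : IsChannel D

/-- A quantum encoding of classical messages with revocation: a QECM with an unkeyed revocation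
channel `R` and a keyed verification channel `V` that outputs one qubit. The revocation token space
is `ℂ^𝓡`, and `true` is the accepting state of the qubit. -/
structure QECMR (𝓚 𝓜 𝓒 𝓡 : Type*) [Fintype 𝓚] [DecidableEq 𝓚] [Fintype 𝓜] [DecidableEq 𝓜]
    [Fintype 𝓒] [DecidableEq 𝓒] [Fintype 𝓡] [DecidableEq 𝓡] extends QECM 𝓚 𝓜 𝓒 where
  /-- revocation -/
  R : Op 𝓒 →ₗ[ℂ] Op 𝓡
  /-- verification -/
  V : Op (𝓚 × 𝓡) →ₗ[ℂ] Op Bool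
  isChannel_R : IsChannel R
  isChannel_V : IsChannel V

section Schemes

variable {𝓚 𝓜 𝓒 𝓡 : Type*} [Fintype 𝓚] [DecidableEq 𝓚] [Fintype 𝓜] [DecidableEq 𝓜]
  [Fintype 𝓒] [DecidableEq 𝓒] [Fintype 𝓡] [DecidableEq 𝓡]

namespace QECM

/-- The probability `⟨k| K(ε) |k⟩` of sampling the key `k`, where the empty input is the unique
density operator `1` on `ℂ`. -/
def keyProb (S : QECM 𝓚 𝓜 𝓒) (k : 𝓚) : ℝ := (S.K 1 k k).re

/-- `E_k(ρ) = E(|k⟩⟨k| ⊗ ρ)`. -/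
def Ek (S : QECM 𝓚 𝓜 𝓒) (k : 𝓚) (ρ : Op 𝓜) : Op 𝓒 := S.E (basisState k ⊗ₖ ρ)

/-- `D_k(ρ) = D(|k⟩⟨k| ⊗ ρ)`. -/
def Dk (S : QECM 𝓚 𝓜 𝓒) (k : 𝓚) (ρ : Op 𝓒) : Op 𝓜 := S.D (basisState k ⊗ₖ ρ)

/-- Every message is recovered with probability at least `1 - ε`, averaged over the key. -/
def IsCorrect (S : QECM 𝓚 𝓜 𝓒) (ε : ℝ) : Prop :=
  ∀ m : 𝓜, 1 - ε ≤ ∑ k, S.keyProb k * (S.Dk k (S.Ek k (basisState m)) m m).re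

/-- The key-averaged ciphertexts of any two messages are within trace distance `δ`. -/
def IsEncrypting (S : QECM 𝓚 𝓜 𝓒) (δ : ℝ) : Prop :=
  ∀ m₀ m₁ : 𝓜,
    1 / 2 * traceNorm (∑ k, (S.keyProb k : ℂ) • S.Ek k (basisState m₀ - basisState m₁)) ≤ δ

end QECM

namespace QECMR

/-- The functional `ρ ↦ ⟨1| V(|k⟩⟨k| ⊗ ρ) |1⟩`. -/
def acceptMap (S : QECMR 𝓚 𝓜 𝓒 𝓡) (k : 𝓚) : Op 𝓡 →ₗ[ℂ] ℂ where
  toFun ρ := S.V (basisState k ⊗ₖ ρ) true true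
  map_add' ρ σ := by rw [Matrix.kronecker_add, map_add, Matrix.add_apply]
  map_smul' c ρ := by rw [Matrix.kronecker_smul, map_smul, Matrix.smul_apply, RingHom.id_apply]

/-- Correctness of the underlying QECM, and honest revocation tokens are accepted with probability
at least `1 - ε`, averaged over the key. -/
def IsCorrect (S : QECMR 𝓚 𝓜 𝓒 𝓡) (ε : ℝ) : Prop :=
  S.toQECM.IsCorrect ε ∧
    ∀ m : 𝓜, 1 - ε ≤ ∑ k, S.keyProb k * (S.acceptMap k (S.R (S.Ek k (basisState m)))).re

/-- `δ`-revocation security, against all channels `A : L(ℂ^𝓒) → L(ℂ^𝓡 ⊗ ℂ^d)` for all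
dimensions `d`. -/
def HasRevocationSecurity (S : QECMR 𝓚 𝓜 𝓒 𝓡) (δ : ℝ) : Prop :=
  ∀ (m m' : 𝓜) (d : ℕ) (A : Op 𝓒 →ₗ[ℂ] Op (𝓡 × Fin d)), IsChannel A →
    ∑ k, S.keyProb k * (1 / 2 * traceNorm (functionalTensorId (S.acceptMap k) (Fin d)
      (A (S.Ek k (basisState m - basisState m'))))) ≤ δ

end QECMR

end Schemes

end

end QuantumRevocation

/-!
Let `t` be the trace distance of the key-averaged ciphertexts `ρ₀`, `ρ₁` of two messages. It is
attained by a reflection `U`, the difference of the two Helstrom projections: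
`2 t = Tr (U (ρ₀ - ρ₁))`. The adversary applies the two-outcome measurement with Kraus operators
`a + b U` and `a - b U`, where `2 (a² + b²) = 1`, then revokes honestly and keeps the outcome. On
average this measurement acts as `ρ ↦ 2 a² ρ + 2 b² U ρ U`, so the token is accepted with
probability at least `2 a² (1 - ε)`, while the outcome distinguishes the two messages with bias
`4 a b t`. Revocation security hence gives `4 a b t ≤ δ + 2 a² ε + 2 b²`. Dividing by `a²` makes
this a quadratic inequality in `b / a`, whose discriminant yields `t² ≤ (1 + δ) (δ + ε)`.
-/

namespace QuantumRevocation

open scoped Matrix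

noncomputable section

section TraceNorm

variable {ι : Type*} [Fintype ι] [DecidableEq ι]

theorem traceNorm_eq_re_trace_abs (X : Op ι) : traceNorm X = (CFC.abs X).trace.re := rfl

theorem traceNorm_diagonal (f : ι → ℂ) : traceNorm (Matrix.diagonal f) = ∑ i, ‖f i‖ := by
  have habs : CFC.abs (Matrix.diagonal f) = Matrix.diagonal fun i => (‖f i‖ : ℂ) := by
    refine CFC.sqrt_unique ?_ (Matrix.PosSemidef.diagonal fun i => ?_).nonneg
    · simp [Matrix.star_eq_conjTranspose, Matrix.diagonal_conjTranspose, Complex.conj_mul', sq]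
    · exact Complex.zero_le_real.mpr (norm_nonneg (f i))
  simp [traceNorm_eq_re_trace_abs, habs, Matrix.trace_diagonal]

theorem exists_reflection_mul_eq_abs {X : Op ι} (hX : X.IsHermitian) :
    ∃ U : Op ι, U.IsHermitian ∧ U * U = 1 ∧ U * X = CFC.abs X := by
  have hXsa : IsSelfAdjoint X := hX
  have hcont (f : ℝ → ℝ) : ContinuousOn f (spectrum ℝ X) :=
    Matrix.finite_real_spectrum.continuousOn f
  -- Unlike `SignType.sign`, this sign function has no zero, so it squares to `1`.
  let sgn : ℝ → ℝ := fun x => if 0 ≤ x then 1 else -1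
  have hsgn_sq (x : ℝ) : sgn x * sgn x = 1 := by by_cases h : 0 ≤ x <;> simp [sgn, h]
  have hsgn_mul (x : ℝ) : sgn x * x = ‖x‖ := by
    rcases le_or_gt 0 x with h | h
    · simp [sgn, h, abs_of_nonneg h]
    · simp [sgn, h.not_ge, abs_of_neg h]
  refine ⟨cfc sgn X, cfc_predicate sgn X, ?_, ?_⟩
  · rw [← cfc_mul sgn sgn X (hcont _) (hcont _)]
    simp only [hsgn_sq, cfc_const_one ℝ X]
  · calc cfc sgn X * X = cfc sgn X * cfc (fun x : ℝ => x) X := by rw [cfc_id' ℝ X]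
      _ = CFC.abs X := by
        rw [← cfc_mul _ _ X (hcont _) (hcont _), CFC.abs_eq_cfc_norm X]
        simp only [hsgn_mul]

end TraceNorm

section WeakMeasurement

variable {ι : Type*} [Fintype ι] [DecidableEq ι] {U : Op ι}

/-- The operator `a + b U`. For a reflection `U` and `2 (a² + b²) = 1`, the operators
`weakKraus U a b` and `weakKraus U a (-b)` are the Kraus operators of a two-outcome measurement of
`U`, which interpolates between doing nothing (`b = 0`) and the projective measurement
(`a = b`). -/
def weakKraus {ι : Type*} [DecidableEq ι] (U : Op ι) (a b : ℝ) : Op ι :=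
  a • (1 : Op ι) + b • U

theorem isHermitian_weakKraus {ι : Type*} [DecidableEq ι] {U : Op ι} (hU : U.IsHermitian)
    (a b : ℝ) : (weakKraus U a b).IsHermitian := by
  simp [weakKraus, Matrix.IsHermitian, Matrix.conjTranspose_smul, hU.eq]

theorem weakKraus_mul_self (hUU : U * U = 1) (a b : ℝ) :
    weakKraus U a b * weakKraus U a b = (a ^ 2 + b ^ 2) • (1 : Op ι) + (2 * a * b) • U := by
  simp only [weakKraus, add_mul, mul_add, smul_mul_smul_comm, one_mul, mul_one, hUU]
  module

theorem weakKraus_mul_self_add (hUU : U * U = 1) {a b : ℝ} (hab : 2 * (a ^ 2 + b ^ 2) = 1) :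
    weakKraus U a b * weakKraus U a b + weakKraus U a (-b) * weakKraus U a (-b) = 1 := by
  calc _ = (2 * (a ^ 2 + b ^ 2)) • (1 : Op ι) := by
        rw [weakKraus_mul_self hUU, weakKraus_mul_self hUU]
        module
    _ = 1 := by rw [hab, one_smul]

theorem weakKraus_mul_mul_add (U ρ : Op ι) (a b : ℝ) :
    weakKraus U a b * ρ * weakKraus U a b + weakKraus U a (-b) * ρ * weakKraus U a (-b) =
      (2 * a ^ 2) • ρ + (2 * b ^ 2) • (U * ρ * U) := by
  simp only [weakKraus, add_mul, mul_add, smul_mul_assoc, mul_smul_comm, one_mul, mul_one]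
  module

theorem re_trace_weakKraus_mul_mul (hUU : U * U = 1) (ρ : Op ι) (a b : ℝ) :
    (weakKraus U a b * ρ * weakKraus U a b).trace.re =
      (a ^ 2 + b ^ 2) * ρ.trace.re + 2 * a * b * (U * ρ).trace.re := by
  rw [Matrix.trace_mul_cycle, weakKraus_mul_self hUU]
  simp only [add_mul, smul_mul_assoc, one_mul, Matrix.trace_add, Matrix.trace_smul,
    Complex.add_re, Complex.smul_re, smul_eq_mul]

theorem posSemidef_weakKraus_mul_mul (hU : U.IsHermitian) {ρ : Op ι} (hρ : ρ.PosSemidef)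
    (a b : ℝ) : (weakKraus U a b * ρ * weakKraus U a b).PosSemidef := by
  simpa only [(isHermitian_weakKraus hU a b).eq] using
    hρ.mul_mul_conjTranspose_same (weakKraus U a b)

theorem le_map_weakKraus_add (hU : U.IsHermitian) {ρ : Op ι} (hρ : ρ.PosSemidef)
    {f : Op ι →ₗ[ℂ] ℂ} (hf : ∀ σ : Op ι, σ.PosSemidef → 0 ≤ (f σ).re) (a b : ℝ) :
    2 * a ^ 2 * (f ρ).re ≤ (f (weakKraus U a b * ρ * weakKraus U a b)).re +
      (f (weakKraus U a (-b) * ρ * weakKraus U a (-b))).re := by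
  have hUρU : 0 ≤ (f (U * ρ * U)).re :=
    hf _ (by simpa only [hU.eq] using hρ.mul_mul_conjTranspose_same U)
  rw [← Complex.add_re, ← map_add, weakKraus_mul_mul_add, map_add, f.map_smul_of_tower,
    f.map_smul_of_tower, Complex.add_re, Complex.smul_re, Complex.smul_re, smul_eq_mul, smul_eq_mul]
  exact le_add_of_nonneg_right (mul_nonneg (by positivity) hUρU)

theorem abs_re_trace_reflection_mul_le (hU : U.IsHermitian) (hUU : U * U = 1) {ρ : Op ι}
    (hρ : ρ.PosSemidef) : |(U * ρ).trace.re| ≤ ρ.trace.re := by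
  have hpos (b : ℝ) : 0 ≤ (weakKraus U (1 / 2) b * ρ * weakKraus U (1 / 2) b).trace.re :=
    (Complex.le_def.mp (posSemidef_weakKraus_mul_mul hU hρ _ b).trace_nonneg).1
  have hplus := hpos (1 / 2)
  have hminus := hpos (-(1 / 2))
  rw [re_trace_weakKraus_mul_mul hUU] at hplus hminus
  exact abs_le.mpr ⟨by linarith, by linarith⟩

theorem traceNorm_sub_le {ρ σ : Op ι} (hρ : ρ.PosSemidef) (hσ : σ.PosSemidef) :
    traceNorm (ρ - σ) ≤ ρ.trace.re + σ.trace.re := by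
  obtain ⟨U, hU, hUU, habs⟩ := exists_reflection_mul_eq_abs (hρ.isHermitian.sub hσ.isHermitian)
  rw [traceNorm_eq_re_trace_abs, ← habs, mul_sub, Matrix.trace_sub, Complex.sub_re]
  linarith [(abs_le.mp (abs_re_trace_reflection_mul_le hU hUU hρ)).2,
    (abs_le.mp (abs_re_trace_reflection_mul_le hU hUU hσ)).1]

end WeakMeasurement

section Channels

theorem posSemidef_basisState {ι : Type*} [DecidableEq ι] (a : ι) :
    (basisState a).PosSemidef := by
  rw [basisState, ← Matrix.diagonal_single]
  exact Matrix.PosSemidef.diagonal (Pi.single_nonneg.mpr zero_le_one)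

theorem trace_basisState {ι : Type*} [Fintype ι] [DecidableEq ι] (a : ι) :
    (basisState a).trace = 1 :=
  Matrix.trace_single_eq_same a 1

theorem posSemidef_blockDiagonal {ι β : Type*} [Finite ι] [Finite β] [DecidableEq β]
    {Y : β → Op ι} (hY : ∀ b, (Y b).PosSemidef) : (Matrix.blockDiagonal Y).PosSemidef := by
  classical
  cases nonempty_fintype ι
  cases nonempty_fintype β
  choose B hB using fun b => CStarAlgebra.nonneg_iff_eq_star_mul_self.mp (hY b).nonneg
  obtain rfl : Y = fun b => (B b)ᴴ * B b := funext hB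
  rw [Matrix.blockDiagonal_mul, ← Matrix.blockDiagonal_conjTranspose]
  exact Matrix.posSemidef_conjTranspose_mul_self _

variable {ι κ ν β : Type*} [Fintype ι]

theorem IsChannel.map_posSemidef [Fintype κ] {Φ : Op ι →ₗ[ℂ] Op κ} (hΦ : IsChannel Φ) {X : Op ι}
    (hX : X.PosSemidef) : (Φ X).PosSemidef :=
  (hΦ.completelyPositive 1 _ (hX.submatrix Prod.fst)).submatrix fun i => (i, (0 : Fin 1))

/-- The map that measures with Kraus operators `M b`, applies `Φ` to the post-measurement state and
records the outcome `b` in a classical register, the second tensor factor of the output. -/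
def measureThen [DecidableEq β] (Φ : Op ν →ₗ[ℂ] Op κ) (M : β → Matrix ν ι ℂ) :
    Op ι →ₗ[ℂ] Op (κ × β) where
  toFun ρ := Matrix.blockDiagonal fun b => Φ (M b * ρ * (M b)ᴴ)
  map_add' ρ σ := by
    simp only [Matrix.mul_add, Matrix.add_mul, map_add, ← Matrix.blockDiagonal_add]
    rfl
  map_smul' c ρ := by
    simp only [Matrix.mul_smul, Matrix.smul_mul, map_smul, RingHom.id_apply,
      ← Matrix.blockDiagonal_smul]
    rfl

theorem measureThen_apply [DecidableEq β] (Φ : Op ν →ₗ[ℂ] Op κ) (M : β → Matrix ν ι ℂ)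
    (ρ : Op ι) : measureThen Φ M ρ = Matrix.blockDiagonal fun b => Φ (M b * ρ * (M b)ᴴ) :=
  rfl

theorem functionalTensorId_blockDiagonal [DecidableEq β] (φ : Op κ →ₗ[ℂ] ℂ) (Y : β → Op κ) :
    functionalTensorId φ β (Matrix.blockDiagonal Y) = Matrix.diagonal fun b => φ (Y b) := by
  ext b c
  obtain rfl | h := eq_or_ne b c
  · simp only [functionalTensorId, LinearMap.coe_mk, AddHom.coe_mk, Matrix.of_apply,
      Matrix.blockDiagonal_apply_eq, Matrix.diagonal_apply_eq]
    rfl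
  · simp only [functionalTensorId, LinearMap.coe_mk, AddHom.coe_mk, Matrix.of_apply,
      Matrix.blockDiagonal_apply_ne _ _ _ h, Matrix.diagonal_apply_ne _ h]
    exact φ.map_zero

theorem block_kronecker_one_mul_mul {ζ : Type*} [Fintype ζ] [DecidableEq ζ] (L : Matrix ν ι ℂ)
    (X : Op (ι × ζ)) (z w : ζ) :
    (Matrix.of fun i j => ((L ⊗ₖ (1 : Op ζ)) * X * (L ⊗ₖ (1 : Op ζ))ᴴ) (i, z) (j, w)) =
      L * (Matrix.of fun i j => X (i, z) (j, w)) * Lᴴ := by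
  ext i j
  simp [Matrix.mul_apply, Fintype.sum_prod_type, Matrix.one_apply, Finset.sum_mul, apply_ite]

theorem tensorId_measureThen [DecidableEq β] {ζ : Type*} [Fintype ζ] [DecidableEq ζ]
    (Φ : Op ν →ₗ[ℂ] Op κ) (M : β → Matrix ν ι ℂ) (X : Op (ι × ζ)) :
    tensorId (measureThen Φ M) ζ X =
      (Matrix.blockDiagonal fun b =>
        tensorId Φ ζ ((M b ⊗ₖ (1 : Op ζ)) * X * (M b ⊗ₖ (1 : Op ζ))ᴴ)).submatrix
          (fun p => ((p.1.1, p.2), p.1.2)) (fun p => ((p.1.1, p.2), p.1.2)) := by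
  ext p q
  simp only [tensorId, measureThen_apply, LinearMap.coe_mk, AddHom.coe_mk, Matrix.of_apply,
    Matrix.submatrix_apply, Matrix.blockDiagonal_apply, block_kronecker_one_mul_mul]

theorem trace_measureThen [Fintype κ] [Fintype ν] [Fintype β] [DecidableEq β] [DecidableEq ι]
    {Φ : Op ν →ₗ[ℂ] Op κ} (hΦ : ∀ X, (Φ X).trace = X.trace) {M : β → Matrix ν ι ℂ}
    (hM : ∑ b, (M b)ᴴ * M b = 1) (ρ : Op ι) : (measureThen Φ M ρ).trace = ρ.trace := by
  simp only [measureThen_apply, Matrix.trace_blockDiagonal, hΦ, Matrix.trace_mul_cycle _ ρ]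
  rw [← Matrix.trace_sum, ← Matrix.sum_mul, hM, one_mul]

theorem isChannel_measureThen [Fintype κ] [Fintype ν] [Fintype β] [DecidableEq β] [DecidableEq ι]
    {Φ : Op ν →ₗ[ℂ] Op κ} (hΦ : IsChannel Φ) {M : β → Matrix ν ι ℂ}
    (hM : ∑ b, (M b)ᴴ * M b = 1) : IsChannel (measureThen Φ M) where
  completelyPositive n X hX := by
    rw [tensorId_measureThen]
    exact (posSemidef_blockDiagonal fun b =>
      hΦ.completelyPositive n _ (hX.mul_mul_conjTranspose_same _)).submatrix _
  tracePreserving := trace_measureThen hΦ.tracePreserving hM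

end Channels

section Schemes

variable {𝓚 𝓜 𝓒 𝓡 : Type*} [Fintype 𝓚] [DecidableEq 𝓚] [Fintype 𝓜] [DecidableEq 𝓜]
  [Fintype 𝓒] [DecidableEq 𝓒] [Fintype 𝓡] [DecidableEq 𝓡]

namespace QECM

theorem keyProb_nonneg (S : QECM 𝓚 𝓜 𝓒) (k : 𝓚) : 0 ≤ S.keyProb k :=
  (Complex.le_def.mp (S.isChannel_K.map_posSemidef Matrix.PosSemidef.one).diag_nonneg).1

theorem sum_keyProb (S : QECM 𝓚 𝓜 𝓒) : ∑ k, S.keyProb k = 1 := by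
  simpa [Matrix.trace, keyProb] using congrArg Complex.re (S.isChannel_K.tracePreserving 1)

theorem Ek_sub (S : QECM 𝓚 𝓜 𝓒) (k : 𝓚) (ρ σ : Op 𝓜) :
    S.Ek k (ρ - σ) = S.Ek k ρ - S.Ek k σ := by
  have hkron : basisState k ⊗ₖ (ρ - σ) = basisState k ⊗ₖ ρ - basisState k ⊗ₖ σ := by
    ext
    simp [mul_sub]
  rw [Ek, Ek, Ek, hkron, map_sub]

theorem posSemidef_Ek_basisState (S : QECM 𝓚 𝓜 𝓒) (k : 𝓚) (m : 𝓜) :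
    (S.Ek k (basisState m)).PosSemidef :=
  S.isChannel_E.map_posSemidef ((posSemidef_basisState k).kronecker (posSemidef_basisState m))

theorem trace_Ek (S : QECM 𝓚 𝓜 𝓒) (k : 𝓚) (ρ : Op 𝓜) : (S.Ek k ρ).trace = ρ.trace := by
  rw [Ek, S.isChannel_E.tracePreserving, Matrix.trace_kronecker, trace_basisState, one_mul]

/-- The key-averaged ciphertext `𝔼_k E_k(m)` of the message `m`: the state seen by someone who does
not know the key. -/
def averageCipher (S : QECM 𝓚 𝓜 𝓒) (m : 𝓜) : Op 𝓒 :=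
  ∑ k, (S.keyProb k : ℂ) • S.Ek k (basisState m)

theorem posSemidef_averageCipher (S : QECM 𝓚 𝓜 𝓒) (m : 𝓜) : (S.averageCipher m).PosSemidef :=
  Matrix.posSemidef_sum _ fun k _ =>
    (S.posSemidef_Ek_basisState k m).smul (by exact_mod_cast S.keyProb_nonneg k)

theorem trace_averageCipher (S : QECM 𝓚 𝓜 𝓒) (m : 𝓜) : (S.averageCipher m).trace = 1 := by
  simp only [averageCipher, Matrix.trace_sum, Matrix.trace_smul, trace_Ek, trace_basisState,
    smul_eq_mul, mul_one]
  exact_mod_cast S.sum_keyProb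

theorem re_trace_mul_averageCipher_mul (S : QECM 𝓚 𝓜 𝓒) (L N : Op 𝓒) (m : 𝓜) :
    (L * S.averageCipher m * N).trace.re =
      ∑ k, S.keyProb k * (L * S.Ek k (basisState m) * N).trace.re := by
  simp [averageCipher, Matrix.mul_sum, Matrix.sum_mul, Matrix.trace_sum, Matrix.trace_smul]

theorem sum_smul_Ek_sub (S : QECM 𝓚 𝓜 𝓒) (m₀ m₁ : 𝓜) :
    ∑ k, (S.keyProb k : ℂ) • S.Ek k (basisState m₀ - basisState m₁) =
      S.averageCipher m₀ - S.averageCipher m₁ := by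
  simp only [averageCipher, Ek_sub, smul_sub, Finset.sum_sub_distrib]

theorem half_traceNorm_averageCipher_sub_le_one (S : QECM 𝓚 𝓜 𝓒) (m₀ m₁ : 𝓜) :
    1 / 2 * traceNorm (S.averageCipher m₀ - S.averageCipher m₁) ≤ 1 := by
  have h := traceNorm_sub_le (S.posSemidef_averageCipher m₀) (S.posSemidef_averageCipher m₁)
  simp only [trace_averageCipher, Complex.one_re] at h
  linarith

end QECM

namespace QECMR

variable {S : QECMR 𝓚 𝓜 𝓒 𝓡} {ε δ : ℝ}

theorem re_acceptMap_nonneg (S : QECMR 𝓚 𝓜 𝓒 𝓡) (k : 𝓚) {ρ : Op 𝓡} (hρ : ρ.PosSemidef) :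
    0 ≤ (S.acceptMap k ρ).re :=
  (Complex.le_def.mp (S.isChannel_V.map_posSemidef
    ((posSemidef_basisState k).kronecker hρ)).diag_nonneg).1

theorem re_acceptMap_le_re_trace (S : QECMR 𝓚 𝓜 𝓒 𝓡) (k : 𝓚) {ρ : Op 𝓡} (hρ : ρ.PosSemidef) :
    (S.acceptMap k ρ).re ≤ ρ.trace.re := by
  have hV := S.isChannel_V.map_posSemidef ((posSemidef_basisState k).kronecker hρ)
  have hreject : 0 ≤ (S.V (basisState k ⊗ₖ ρ) false false).re :=
    (Complex.le_def.mp hV.diag_nonneg).1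
  calc (S.acceptMap k ρ).re ≤ (S.V (basisState k ⊗ₖ ρ)).trace.re := by
        rw [Matrix.trace, Fintype.sum_bool, Complex.add_re]
        exact le_add_of_nonneg_right hreject
    _ = ρ.trace.re := by
        rw [S.isChannel_V.tracePreserving, Matrix.trace_kronecker, trace_basisState, one_mul]

/-- The probability, averaged over the key, that a ciphertext `ρ` of `m` is mapped to `L ρ L†` by
a measurement with Kraus operator `L` and that the honest token `R(L ρ L†)` is then accepted. -/
def acceptProb (S : QECMR 𝓚 𝓜 𝓒 𝓡) (L : Op 𝓒) (m : 𝓜) : ℝ :=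
  ∑ k, S.keyProb k * (S.acceptMap k (S.R (L * S.Ek k (basisState m) * Lᴴ))).re

theorem acceptProb_le (S : QECMR 𝓚 𝓜 𝓒 𝓡) (L : Op 𝓒) (m : 𝓜) :
    S.acceptProb L m ≤ (L * S.averageCipher m * Lᴴ).trace.re := by
  rw [S.re_trace_mul_averageCipher_mul]
  refine Finset.sum_le_sum fun k _ => mul_le_mul_of_nonneg_left ?_ (S.keyProb_nonneg k)
  rw [← S.isChannel_R.tracePreserving]
  exact S.re_acceptMap_le_re_trace k (S.isChannel_R.map_posSemidef
    ((S.posSemidef_Ek_basisState k m).mul_mul_conjTranspose_same L))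

theorem acceptProb_weakKraus_le (S : QECMR 𝓚 𝓜 𝓒 𝓡) {U : Op 𝓒} (hU : U.IsHermitian)
    (hUU : U * U = 1) (a b : ℝ) (m : 𝓜) :
    S.acceptProb (weakKraus U a b) m ≤
      a ^ 2 + b ^ 2 + 2 * a * b * (U * S.averageCipher m).trace.re := by
  have h := S.acceptProb_le (weakKraus U a b) m
  rwa [(isHermitian_weakKraus hU a b).eq, re_trace_weakKraus_mul_mul hUU,
    S.trace_averageCipher, Complex.one_re, mul_one] at h

/-- The revocation half of `IsCorrect`: honest revocation tokens are accepted with probability at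
least `1 - ε`, averaged over the key. -/
def IsRevocationCorrect (S : QECMR 𝓚 𝓜 𝓒 𝓡) (ε : ℝ) : Prop :=
  ∀ m : 𝓜, 1 - ε ≤ ∑ k, S.keyProb k * (S.acceptMap k (S.R (S.Ek k (basisState m)))).re

theorem IsCorrect.isRevocationCorrect (hS : S.IsCorrect ε) : S.IsRevocationCorrect ε := hS.2

theorem IsRevocationCorrect.le_acceptProb_one (hS : S.IsRevocationCorrect ε) (m : 𝓜) :
    1 - ε ≤ S.acceptProb 1 m := by
  simpa only [acceptProb, Matrix.conjTranspose_one, one_mul, mul_one] using hS m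

theorem IsRevocationCorrect.nonneg (hS : S.IsRevocationCorrect ε) (m : 𝓜) : 0 ≤ ε := by
  have h := (hS.le_acceptProb_one m).trans (S.acceptProb_le 1 m)
  simp only [Matrix.conjTranspose_one, one_mul, mul_one, QECM.trace_averageCipher,
    Complex.one_re] at h
  linarith

theorem IsRevocationCorrect.le_acceptProb_weakKraus_add (hS : S.IsRevocationCorrect ε)
    {U : Op 𝓒} (hU : U.IsHermitian) (a b : ℝ) (m : 𝓜) :
    2 * a ^ 2 * (1 - ε) ≤
      S.acceptProb (weakKraus U a b) m + S.acceptProb (weakKraus U a (-b)) m := by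
  refine (mul_le_mul_of_nonneg_left (hS m) (by positivity)).trans ?_
  rw [acceptProb, acceptProb, ← Finset.sum_add_distrib, Finset.mul_sum]
  refine Finset.sum_le_sum fun k _ => ?_
  rw [← mul_add, mul_left_comm, (isHermitian_weakKraus hU a b).eq,
    (isHermitian_weakKraus hU a (-b)).eq]
  exact mul_le_mul_of_nonneg_left
    (le_map_weakKraus_add hU (S.posSemidef_Ek_basisState k m) (f := S.acceptMap k ∘ₗ S.R)
      (fun σ hσ => S.re_acceptMap_nonneg k (S.isChannel_R.map_posSemidef hσ)) a b)
    (S.keyProb_nonneg k)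

theorem abs_acceptProb_sub_le (S : QECMR 𝓚 𝓜 𝓒 𝓡) (L : Op 𝓒) (m m' : 𝓜) :
    |S.acceptProb L m - S.acceptProb L m'| ≤ ∑ k, S.keyProb k *
      ‖S.acceptMap k (S.R (L * S.Ek k (basisState m - basisState m') * Lᴴ))‖ := by
  rw [acceptProb, acceptProb, ← Finset.sum_sub_distrib]
  refine (Finset.abs_sum_le_sum_abs _ _).trans (Finset.sum_le_sum fun k _ => ?_)
  rw [← mul_sub, abs_mul, abs_of_nonneg (S.keyProb_nonneg k)]
  refine mul_le_mul_of_nonneg_left ?_ (S.keyProb_nonneg k)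
  rw [QECM.Ek_sub, mul_sub, sub_mul, map_sub, map_sub, ← Complex.sub_re]
  exact Complex.abs_re_le_norm _

theorem HasRevocationSecurity.sum_abs_acceptProb_sub_le (hS : S.HasRevocationSecurity δ) {d : ℕ}
    {M : Fin d → Op 𝓒} (hM : ∑ b, (M b)ᴴ * M b = 1) (m m' : 𝓜) :
    1 / 2 * ∑ b, |S.acceptProb (M b) m - S.acceptProb (M b) m'| ≤ δ := by
  refine le_trans ?_ (hS m m' d _ (isChannel_measureThen S.isChannel_R hM))
  simp only [measureThen_apply, functionalTensorId_blockDiagonal, traceNorm_diagonal,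
    mul_left_comm _ (1 / 2 : ℝ), ← Finset.mul_sum]
  refine mul_le_mul_of_nonneg_left ?_ (by norm_num)
  simp only [Finset.mul_sum]
  rw [Finset.sum_comm]
  exact Finset.sum_le_sum fun b _ => S.abs_acceptProb_sub_le (M b) m m'

theorem HasRevocationSecurity.nonneg (hS : S.HasRevocationSecurity δ) (m : 𝓜) : 0 ≤ δ := by
  simpa using hS.sum_abs_acceptProb_sub_le (d := 1) (M := fun _ => 1) (by simp) m m

theorem HasRevocationSecurity.weakKraus_bias_le (hr : S.HasRevocationSecurity δ)
    (hc : S.IsRevocationCorrect ε) {U : Op 𝓒} (hU : U.IsHermitian) (hUU : U * U = 1) {a b : ℝ}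
    (hab : 2 * (a ^ 2 + b ^ 2) = 1) (m₀ m₁ : 𝓜) :
    2 * a * b * (U * (S.averageCipher m₀ - S.averageCipher m₁)).trace.re ≤
      δ + 2 * a ^ 2 * ε + 2 * b ^ 2 := by
  have hcomplete : ∑ i, (![weakKraus U a b, weakKraus U a (-b)] i)ᴴ *
      ![weakKraus U a b, weakKraus U a (-b)] i = 1 := by
    simpa [Fin.sum_univ_two, (isHermitian_weakKraus hU _ _).eq] using weakKraus_mul_self_add hUU hab
  have hsec := hr.sum_abs_acceptProb_sub_le hcomplete m₀ m₁
  simp only [Fin.sum_univ_two, Matrix.cons_val_zero, Matrix.cons_val_one] at hsec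
  have hplus := le_abs_self
    (S.acceptProb (weakKraus U a b) m₀ - S.acceptProb (weakKraus U a b) m₁)
  have hminus := neg_abs_le
    (S.acceptProb (weakKraus U a (-b)) m₀ - S.acceptProb (weakKraus U a (-b)) m₁)
  have haccept₀ := hc.le_acceptProb_weakKraus_add hU a b m₀
  have haccept₁ := hc.le_acceptProb_weakKraus_add hU a b m₁
  have houtcome₀ := S.acceptProb_weakKraus_le hU hUU a (-b) m₀
  have houtcome₁ := S.acceptProb_weakKraus_le hU hUU a b m₁
  rw [mul_sub, Matrix.trace_sub, Complex.sub_re]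
  linarith

theorem HasRevocationSecurity.sq_half_traceNorm_le (hr : S.HasRevocationSecurity δ)
    (hc : S.IsRevocationCorrect ε) (m₀ m₁ : 𝓜) :
    (1 / 2 * traceNorm (S.averageCipher m₀ - S.averageCipher m₁)) ^ 2 ≤ (1 + δ) * (δ + ε) := by
  obtain ⟨U, hU, hUU, habs⟩ := exists_reflection_mul_eq_abs
    ((S.posSemidef_averageCipher m₀).isHermitian.sub (S.posSemidef_averageCipher m₁).isHermitian)
  set T := traceNorm (S.averageCipher m₀ - S.averageCipher m₁)
  have hquad (x : ℝ) : 0 ≤ (1 + δ) * (x * x) + -T * x + (δ + ε) := by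
    -- The constraint `2 (a² + b²) = 1` and `b = x a` determine `a`.
    set a : ℝ := (√(2 * (1 + x ^ 2)))⁻¹
    have ha : a ^ 2 * (2 * (1 + x ^ 2)) = 1 := by
      rw [inv_pow, Real.sq_sqrt (by positivity), inv_mul_cancel₀ (by positivity)]
    have hbias := hr.weakKraus_bias_le hc hU hUU (a := a) (b := x * a) (by linarith) m₀ m₁
    rw [habs, ← traceNorm_eq_re_trace_abs] at hbias
    have hscaled : 0 ≤ 2 * a ^ 2 * ((1 + δ) * (x * x) + -T * x + (δ + ε)) := by
      linear_combination hbias - δ * ha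
    exact nonneg_of_mul_nonneg_right hscaled (by positivity)
  have hdiscrim := discrim_le_zero hquad
  rw [discrim] at hdiscrim
  linarith

end QECMR

end Schemes

theorem min_one_sqrt_le_sqrt {ε δ : ℝ} (hε : 0 ≤ ε) (hδ : 0 ≤ δ) :
    min 1 √((1 + δ) * (δ + ε)) ≤ √(19 * (√δ + 2 * ε ^ (1 / 8 : ℝ))) := by
  have hε_rpow : 0 ≤ ε ^ (1 / 8 : ℝ) := Real.rpow_nonneg hε _
  rcases le_total 1 δ with hδ1 | hδ1
  · have : 1 ≤ √δ := Real.one_le_sqrt.mpr hδ1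
    exact min_le_of_left_le (Real.one_le_sqrt.mpr (by linarith))
  rcases le_total 1 ε with hε1 | hε1
  · have : 1 ≤ ε ^ (1 / 8 : ℝ) := Real.one_le_rpow hε1 (by norm_num)
    exact min_le_of_left_le (Real.one_le_sqrt.mpr (by linarith [Real.sqrt_nonneg δ]))
  have hδ_sqrt : δ ≤ √δ := Real.le_sqrt_of_sq_le (pow_le_of_le_one hδ hδ1 two_ne_zero)
  have hε_le : ε ≤ ε ^ (1 / 8 : ℝ) := Real.self_le_rpow_of_le_one hε hε1 (by norm_num)
  refine min_le_of_right_le (Real.sqrt_le_sqrt ?_)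
  calc (1 + δ) * (δ + ε) ≤ 2 * (δ + ε) := by gcongr; linarith
    _ ≤ 19 * (√δ + 2 * ε ^ (1 / 8 : ℝ)) := by linarith

end

end QuantumRevocation

theorem mainTheorem7_general {𝓚 𝓜 𝓒 𝓡 : Type*} [Fintype 𝓚] [DecidableEq 𝓚] [Fintype 𝓜]
    [DecidableEq 𝓜] [Fintype 𝓒] [DecidableEq 𝓒] [Fintype 𝓡] [DecidableEq 𝓡]
    (S : QuantumRevocation.QECMR 𝓚 𝓜 𝓒 𝓡) (ε δ : ℝ)
    (hcorrect : S.IsRevocationCorrect ε) (hrevocation : S.HasRevocationSecurity δ) :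
    S.toQECM.IsEncrypting (min 1 √((1 + δ) * (δ + ε))) := by
  intro m₀ m₁
  rw [S.sum_smul_Ek_sub]
  exact le_min (S.half_traceNorm_averageCipher_sub_le_one m₀ m₁)
    (Real.le_sqrt_of_sq_le (hrevocation.sq_half_traceNorm_le hcorrect m₀ m₁))

theorem mainTheorem7 {𝓚 𝓜 𝓒 𝓡 : Type*} [Fintype 𝓚] [DecidableEq 𝓚] [Fintype 𝓜] [DecidableEq 𝓜]
    [Fintype 𝓒] [DecidableEq 𝓒] [Fintype 𝓡] [DecidableEq 𝓡]
    (S : QuantumRevocation.QECMR 𝓚 𝓜 𝓒 𝓡) (ε δ : ℝ)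
    (hcorrect : S.IsCorrect ε) (hrevocation : S.HasRevocationSecurity δ) :
    S.toQECM.IsEncrypting (√(19 * (√δ + 2 * ε ^ (1 / 8 : ℝ)))) :=
  fun m₀ m₁ => (mainTheorem7_general S ε δ hcorrect.isRevocationCorrect hrevocation m₀ m₁).trans
    (QuantumRevocation.min_one_sqrt_le_sqrt
      (hcorrect.isRevocationCorrect.nonneg m₀) (hrevocation.nonneg m₀))
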